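/- Theorem (Bound for the Lipschitz constant). Let $s\ge 1$ be an integer and $0\le\rho<\pi$. Let $\psi\in C^{s+1}(\mathbb{R})$ be real-valued, and let $w\in C_c^{s+1}(\mathbb{R})$ be a $C^{s+1}$-bump on $(-\pi,\pi)$ with plateau $[-\rho,\rho]$, that is, $0\le w\le 1$ on $(-\pi,\pi)$, $w=0$ on $\mathbb{R}\setminus(-\pi,\pi)$ and $w=1$ on $[-\rho,\rho]$. Let $M_\psi,M_{\psi_{s+1}}\ge 0$ be constants such that $$|\psi(x)|\le M_\psi\quad\text{and}\quad|\psi^{(s+1)}(x)|\le M_{\psi_{s+1}}\qquad\text{for all }x\in(-\pi,\pi).$$ Let $\psi_w$ be the $2\pi$-periodic function that equals $w\psi$ on $(-\pi,\pi)$ and takes the value $\frac12\big((w\psi)(-\pi^+)+(w\psi)(\pi^-)\big)$ at $\pi$. Then $\psi_w\in C^{s+1}(\mathbb{R})$, $w^{(s+1)}$ is bounded, and the (smallest) Lipschitz constant $L_s$ of $\psi_w^{(s)}$ over $[-\pi,\pi]$ exists and satisfies $$L_s\le M_{\psi_{s+1}}+M_\psi\,\|w^{(s+1)}\|_\infty+\frac{C_{s,\psi}\,C_{s,w}}{(2\pi)^{s+1}}\,K_s,$$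 where $\|w^{(s+1)}\|_\infty=\sup_{x\in\mathbb{R}}|w^{(s+1)}(x)|$, $$C_{s,\psi}=M_\psi+\frac{(2\pi)^{s+1}}{(s+1)!}M_{\psi_{s+1}},\qquad C_{s,w}=1+\frac{(2\pi)^{s+1}}{(s+1)!}\|w^{(s+1)}\|_\infty,\qquad K_s=\frac{2^{2s+1}\,s^2\,(3s)!}{(2s+1)!}.$$ -/

import Mathlib

open Set Topology

namespace WindowedFourier

noncomputable section

/-- The translation operator, `(T_t f)(x) = f (x + t)`. -/
def translation (t : ℝ) (f : ℝ → ℝ) : ℝ → ℝ := fun x => f (x + t)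

/-- The scaling operator, `(S_a f)(x) = f (a x)`. -/
def scaling (a : ℝ) (f : ℝ → ℝ) : ℝ → ℝ := fun x => f (a * x)

/-- The periodization operator `P_lam`: the `2 lam`-periodic function that equals `f` on
`(-lam, lam)` and equals the mean of the one-sided limits `f(-lam⁺)` and `f(lam⁻)` at `lam`.
Here `toIocMod _ (-lam) x` is the representative of `x` modulo `2 lam` in `(-lam, lam]`. -/
def periodization (lam : ℝ) (hlam : 0 < lam) (f : ℝ → ℝ) : ℝ → ℝ := fun x =>
  if toIocMod (mul_pos two_pos hlam) (-lam) x < lam then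
    f (toIocMod (mul_pos two_pos hlam) (-lam) x)
  else (Function.rightLim f (-lam) + Function.leftLim f lam) / 2

/-- The windowed periodization `ψ_w = P_π S_{lam/π} [w · T_t ψ]`. -/
def windowedPeriodization (lam t : ℝ) (w ψ : ℝ → ℝ) : ℝ → ℝ :=
  periodization Real.pi Real.pi_pos (scaling (lam / Real.pi) (w * translation t ψ))

/-- `w` is a `C^n`-bump with plateau `[-ρ, ρ]` on `(-lam, lam)`. -/
structure IsBump (n : ℕ) (ρ lam : ℝ) (w : ℝ → ℝ) : Prop where
  contDiff : ContDiff ℝ n w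
  hasCompactSupport : HasCompactSupport w
  mem_Icc : ∀ x ∈ Ioo (-lam) lam, 0 ≤ w x ∧ w x ≤ 1
  eq_zero : ∀ x, x ∉ Ioo (-lam) lam → w x = 0
  eq_one : ∀ x ∈ Icc (-ρ) ρ, w x = 1

/-- `L` is the (best) Lipschitz constant of `f` over the set `S`. -/
def IsLipschitzConst (f : ℝ → ℝ) (S : Set ℝ) (L : ℝ) : Prop :=
  IsLeast {K : ℝ | 0 ≤ K ∧ ∀ x ∈ S, ∀ y ∈ S, |f x - f y| ≤ K * |x - y|} L

/-- The supremum norm over `ℝ` (used for bounded functions only). -/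
def supNorm (f : ℝ → ℝ) : ℝ := ⨆ x, |f x|

/-- The constant `A + (2π)^(s+1) / (s+1)! * B`. -/
def constC (s : ℕ) (A B : ℝ) : ℝ :=
  A + (2 * Real.pi) ^ (s + 1) / ((s + 1).factorial : ℝ) * B

/-- The constant `K_s = 2^(2s+1) s² (3s)! / (2s+1)!`. -/
def constK (s : ℕ) : ℝ :=
  2 ^ (2 * s + 1) * (s : ℝ) ^ 2 * ((3 * s).factorial : ℝ) / ((2 * s + 1).factorial : ℝ)

end

end WindowedFourier

/-!
On `(-π, π)` the windowed periodization is `w ψ`, and near `±π` it is a sum of translates of the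
`C^(s+1)` function `w ψ`, which vanishes outside `(-π, π)` (`contDiff_periodization`). The Lipschitz
constant of its `s`-th derivative is thus at most the supremum of `|(w ψ)^(s+1)|` on `(-π, π)`. In
the Leibniz formula the two extreme terms give `M' + M ‖w^(s+1)‖`; the terms
`(s+1 choose j) ψ^(j) w^(s+1-j)` with `1 ≤ j ≤ s` are estimated as follows.

* For `ψ`: let `x ∈ (-π, π)`. One of the two segments of length `π` starting at `x` stays in
  `[-π, π]`, and there the Taylor polynomial of degree `s` at `x` is bounded by
  `C = M + (2π)^(s+1) / (s+1)! M'`. V. A. Markov's inequality at an endpoint then yields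
  `|ψ^(j)(x)| ≤ (2/π)^j T_s^(j)(1) C`, where `T_s` is the Chebyshev polynomial
  (`abs_iteratedDeriv_le_of_Ioo`).
* For `w`: all derivatives of order at most `s + 1` vanish at `±π`, so Taylor's formula at the
  nearest endpoint gives `|w^(s+1-j)(x)| ≤ π^j / j! ‖w^(s+1)‖` (`abs_iteratedDeriv_le_of_eq_zero`).

The powers of `π` cancel, and what remains is the inequality
`∑ (s+1 choose j) 2^j / j! T_s^(j)(1) ≤ K_s / (s+1)!`
(`sum_choose_mul_iterate_derivative_T_le`). The closed form of `T_s^(j)(1)` turns it into an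
inequality between binomial coefficients, which follows from Vandermonde's identity.
-/

namespace WindowedFourier

/-! ### Derivatives of Chebyshev polynomials at `1` and Markov's inequality -/

/-- The closed form of `T_s^(j)(1)`, multiplied by `s + j` so that it also holds for `s = j = 0`. -/
theorem add_mul_iterate_derivative_T_eval_one (s j : ℕ) :
    ((s : ℝ) + j) * ((Polynomial.derivative^[j] (Polynomial.Chebyshev.T ℝ s)).eval 1) =
      s * 2 ^ j * (j.factorial : ℝ) * ((s + j).choose (2 * j) : ℝ) := by
  induction j with
  | zero => simp
  | succ j ih =>
    have hrec := Polynomial.Chebyshev.iterate_derivative_T_eval_one_recurrence (R := ℝ) s j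
    set t := (Polynomial.derivative^[j] (Polynomial.Chebyshev.T ℝ s)).eval 1
    set t' := (Polynomial.derivative^[j + 1] (Polynomial.Chebyshev.T ℝ s)).eval 1
    have hc1 := Nat.add_one_mul_choose_eq (s + j) (2 * j + 1)
    have hc2 := Nat.choose_succ_right_eq (s + j) (2 * j)
    have e : s + (j + 1) = s + j + 1 := rfl
    have e2 : 2 * (j + 1) = 2 * j + 1 + 1 := by ring
    rw [e, e2, Nat.factorial_succ]
    rcases le_or_gt j s with hjs | hjs
    · have e3 : s + j - 2 * j = s - j := by omega
      rw [e3] at hc2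
      have hc1' : ((s : ℝ) + j + 1) * ((s + j).choose (2 * j + 1) : ℝ) =
        ((s + j + 1).choose (2 * j + 1 + 1) : ℝ) * (2 * j + 1 + 1) := by exact_mod_cast hc1
      have hc2' : ((s + j).choose (2 * j + 1) : ℝ) * (2 * j + 1) =
        ((s + j).choose (2 * j) : ℝ) * (s - j) := by
        rw [← Nat.cast_sub hjs]; exact_mod_cast hc2
      push_cast at hrec ⊢
      have h0 : (2 * (j : ℝ) + 1) ≠ 0 := by positivity
      apply mul_left_cancel₀ h0
      linear_combination ((s : ℝ) + j + 1) * hrec + (s + j + 1) * (s - j) * ih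
        + s * 2 ^ j * (j.factorial : ℝ) * (- (s + j + 1) * hc2' + (2 * j + 1) * hc1')
    -- beyond the degree both sides vanish
    · rw [Nat.choose_eq_zero_of_lt (by omega : s + j + 1 < 2 * j + 1 + 1)]
      have : t' = 0 := by
        simp only [t']
        rw [Polynomial.iterate_derivative_eq_zero]
        · simp
        · simp; omega
      simp [this]

theorem iterate_derivative_T_eval_one_nonneg (s j : ℕ) :
    0 ≤ (Polynomial.derivative^[j] (Polynomial.Chebyshev.T ℝ s)).eval 1 :=
  (abs_nonneg _).trans
    (Polynomial.Chebyshev.abs_iterate_derivative_T_real_le s j (x := 1) (by simp))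

/-- V. A. Markov's inequality at the endpoint `1`, for polynomials bounded by `C` on `[-1, 1]`. -/
theorem abs_iterate_derivative_eval_one_le {n j : ℕ} {P : Polynomial ℝ} {C : ℝ}
    (hP : P.degree ≤ n) (hC : 0 ≤ C) (hb : ∀ u ∈ Icc (-1 : ℝ) 1, |P.eval u| ≤ C) :
    |(Polynomial.derivative^[j] P).eval 1| ≤
      C * (Polynomial.derivative^[j] (Polynomial.Chebyshev.T ℝ n)).eval 1 := by
  rcases hC.eq_or_lt with rfl | hC
  -- `P` cannot be normalized by `C = 0`, but then it has infinitely many roots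
  · have : P = 0 := by
      refine Polynomial.eq_zero_of_infinite_isRoot P
        ((Icc_infinite (by norm_num : (-1 : ℝ) < 1)).mono fun u hu => ?_)
      exact abs_nonpos_iff.mp (hb u hu)
    simp [this]
  · have key : ∀ c : ℝ, |c| = C⁻¹ →
        c * (Polynomial.derivative^[j] P).eval 1 ≤
          (Polynomial.derivative^[j] (Polynomial.Chebyshev.T ℝ n)).eval 1 := by
      intro c hc
      have := Polynomial.Chebyshev.eval_iterate_derivative_le_of_forall_abs_le_one
        (n := n) (P := c • P) (k := j) (le_refl (1 : ℝ))
        ((Polynomial.degree_smul_le c P).trans hP) (by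
          intro u hu
          rw [Polynomial.eval_smul, smul_eq_mul, abs_mul, hc, inv_mul_le_iff₀ hC, mul_one]
          exact hb u hu)
      simpa [Polynomial.iterate_derivative_smul, Polynomial.eval_smul] using this
    have h1 := key C⁻¹ (abs_of_pos (inv_pos.mpr hC))
    have h2 := key (-C⁻¹) (by rw [abs_neg, abs_of_pos (inv_pos.mpr hC)])
    rw [inv_mul_le_iff₀ hC] at h1
    rw [neg_mul, ← mul_neg, inv_mul_le_iff₀ hC] at h2
    exact abs_le'.mpr ⟨h1, h2⟩

/-! ### The sum of the Leibniz coefficients -/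

/-- Replacing `4 ^ j` by `4 ^ (s - 1)` for `j < s`, `s + j` by `s + 1` in the denominator and
`(s + j).choose (s - j)` by `(2 * s).choose (s - j)` leaves a Vandermonde sum; this loses too much
only for `s = 1`, where equality holds. -/
theorem sum_choose_mul_choose_div_le {s : ℕ} (hs : 1 ≤ s) :
    ∑ j ∈ Finset.Icc 1 s, (4 : ℝ) ^ j * ((s + 1).choose j : ℝ) * ((s + j).choose (2 * j) : ℝ)
        / (s + j) ≤
      2 * 4 ^ s / (s + 1) * ((3 * s).choose (s - 1) : ℝ) := by
  obtain ⟨m, rfl⟩ : ∃ m, s = m + 1 := ⟨s - 1, by omega⟩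
  -- for `s = 1` both sides equal `4`
  rcases m with _ | m
  · norm_num
  set s := m + 1 + 1 with hsdef
  have hs2 : (2 : ℝ) ≤ s := by rw [hsdef]; push_cast; linarith [Nat.cast_nonneg (α := ℝ) m]
  set B := ((3 * s).choose (s - 1) : ℝ)
  -- Vandermonde's identity bounds the terms with `j < s`
  have hV : ∑ j ∈ Finset.range (s + 1), ((s + 1).choose j : ℝ) * ((2 * s).choose (s - j) : ℝ)
      = ((3 * s + 1).choose s : ℝ) := by
    have := Nat.add_choose_eq (s + 1) (2 * s) s
    rw [Finset.Nat.sum_antidiagonal_eq_sum_range_succ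
      (fun a b => (s + 1).choose a * (2 * s).choose b)] at this
    rw [show 3 * s + 1 = s + 1 + 2 * s by ring, this]
    push_cast; rfl
  have hB : ((3 * s + 1).choose s : ℝ) * s = (3 * s + 1) * B := by
    have := Nat.add_one_mul_choose_eq (3 * s) (s - 1)
    rw [show s - 1 + 1 = s by omega] at this
    simp only [B]
    exact_mod_cast this.symm
  -- the term `j = s`, equal to `4 ^ s * (s + 1) / (2 * s)`, is absorbed by this lower bound
  have hBlow : (s + 1 : ℝ) * s / 2 ≤ B := by
    have h1 : (s + 1).choose (s - 1) ≤ (3 * s).choose (s - 1) :=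
      Nat.choose_le_choose _ (by omega)
    have h2 : (s + 1).choose (s - 1) = (s + 1).choose 2 :=
      Nat.choose_symm_of_eq_add (by omega)
    have h3 : ((s + 1).choose 2 : ℝ) = (s + 1 : ℝ) * s / 2 := by
      rw [Nat.cast_choose_two]; push_cast; ring
    rw [← h3, ← h2]
    exact Nat.cast_le.mpr h1
  have hsmall : ∑ j ∈ Finset.Icc 1 (s - 1),
      (4 : ℝ) ^ j * ((s + 1).choose j : ℝ) * ((s + j).choose (2 * j) : ℝ) / (s + j) ≤
      4 ^ (s - 1) / (s + 1) * ((3 * s + 1).choose s : ℝ) := by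
    rw [← hV, Finset.mul_sum]
    refine (Finset.sum_le_sum fun j hj => ?_).trans
      (Finset.sum_le_sum_of_subset_of_nonneg (s := Finset.Icc 1 (s - 1)) ?_
        fun _ _ _ => by positivity)
    · obtain ⟨hj1, hj2⟩ := Finset.mem_Icc.mp hj
      have hc : (s + j).choose (2 * j) ≤ (2 * s).choose (s - j) := by
        rw [Nat.choose_symm_of_eq_add (show s + j = 2 * j + (s - j) by omega)]
        exact Nat.choose_le_choose _ (by omega)
      have hj1' : (1 : ℝ) ≤ j := by exact_mod_cast hj1
      calc (4 : ℝ) ^ j * ((s + 1).choose j : ℝ) * ((s + j).choose (2 * j) : ℝ) / (s + j)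
          ≤ 4 ^ (s - 1) * ((s + 1).choose j : ℝ) * ((2 * s).choose (s - j) : ℝ) / (s + 1) := by
            gcongr
            norm_num
        _ = _ := by ring
    · intro j hj
      have := Finset.mem_Icc.mp hj
      exact Finset.mem_range.mpr (by omega)
  have hsplit : Finset.Icc 1 s = insert s (Finset.Icc 1 (s - 1)) := by
    ext j; simp only [Finset.mem_Icc, Finset.mem_insert]; omega
  rw [hsplit, Finset.sum_insert (by simp; omega)]
  refine (add_le_add_right hsmall _).trans ?_
  rw [show s + s = 2 * s by ring, Nat.choose_self, Nat.choose_succ_self_right]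
  have h4 : (4 : ℝ) ^ s = 4 * 4 ^ (s - 1) := by
    rw [← pow_succ']; congr 1
  rw [h4, eq_div_of_mul_eq (by positivity) hB]
  have hp : (0 : ℝ) < 4 ^ (s - 1) := by positivity
  generalize (4 : ℝ) ^ (s - 1) = p at hp
  have hσ : (0 : ℝ) < s := by linarith
  push_cast
  generalize (s : ℝ) = σ at *
  have : 2 * (σ + 1) / σ + (3 * σ + 1) * B / σ / (σ + 1) ≤ 8 * B / (σ + 1) := by
    rw [div_div, div_add_div _ _ (by positivity) (by positivity), div_le_div_iff₀ (by positivity)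
      (by positivity)]
    have : 2 * (σ + 1) ^ 2 + (3 * σ + 1) * B ≤ 8 * B * σ := by nlinarith
    have h2 := mul_le_mul_of_nonneg_left this (by positivity : 0 ≤ σ * (σ + 1))
    nlinarith
  have := mul_le_mul_of_nonneg_left this hp.le
  refine le_trans (le_of_eq ?_) (this.trans (le_of_eq ?_))
  · field_simp; ring
  · field_simp; ring

theorem sum_choose_mul_iterate_derivative_T_le {s : ℕ} (hs : 1 ≤ s) :
    ∑ j ∈ Finset.Icc 1 s, ((s + 1).choose j : ℝ) * (2 ^ j / (j.factorial : ℝ)) *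
        (Polynomial.derivative^[j] (Polynomial.Chebyshev.T ℝ s)).eval 1 ≤
      constK s / ((s + 1).factorial : ℝ) := by
  have hσ : (0 : ℝ) < s := by exact_mod_cast hs
  have hK : constK s / ((s + 1).factorial : ℝ) =
      s * (2 * 4 ^ s / (s + 1) * ((3 * s).choose (s - 1) : ℝ)) := by
    obtain ⟨m, rfl⟩ : ∃ m, s = m + 1 := ⟨s - 1, by omega⟩
    rw [Nat.cast_choose ℝ (by omega), show 3 * (m + 1) - (m + 1 - 1) = 2 * (m + 1) + 1 by omega,
      constK, pow_succ, pow_mul, Nat.add_sub_cancel, Nat.factorial_succ (m + 1),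
      Nat.factorial_succ m]
    push_cast
    field_simp
    norm_num
  rw [hK]
  refine le_trans (le_of_eq ?_) (mul_le_mul_of_nonneg_left (sum_choose_mul_choose_div_le hs) hσ.le)
  rw [Finset.mul_sum]
  refine Finset.sum_congr rfl fun j _ => ?_
  have h := add_mul_iterate_derivative_T_eval_one s j
  have h0 : (s : ℝ) + j ≠ 0 := by positivity
  rw [eq_div_of_mul_eq h0 ((mul_comm _ _).trans h), show (4 : ℝ) ^ j = 2 ^ j * 2 ^ j by
    rw [← mul_pow]; norm_num]
  field_simp

/-! ### Bounds for intermediate derivatives -/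

theorem taylor_lagrange_sum {f : ℝ → ℝ} {n : ℕ} (hf : ContDiff ℝ ((n + 1 : ℕ) : WithTop ℕ∞) f)
    {x₀ x : ℝ} (hx : x₀ ≠ x) :
    ∃ ξ ∈ uIoo x₀ x, f x - ∑ k ∈ Finset.range (n + 1),
        (k.factorial : ℝ)⁻¹ * (x - x₀) ^ k * iteratedDeriv k f x₀ =
      iteratedDeriv (n + 1) f ξ * (x - x₀) ^ (n + 1) / ((n + 1).factorial : ℝ) := by
  obtain ⟨ξ, hξ, h⟩ := taylor_mean_remainder_lagrange_iteratedDeriv hx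
    (n := n) (f := f) (by exact_mod_cast hf.contDiffOn)
  refine ⟨ξ, hξ, ?_⟩
  rw [← h, taylor_within_apply]
  congr 1
  refine Finset.sum_congr rfl fun k hk => ?_
  rw [iteratedDerivWithin_eq_iteratedDeriv (uniqueDiffOn_uIcc hx) _ left_mem_uIcc, smul_eq_mul]
  exact (hf.of_le (by exact_mod_cast (Finset.mem_range.mp hk).le)).contDiffAt

theorem abs_le_on_Icc_of_Ioo {g : ℝ → ℝ} (hg : Continuous g) {a b C : ℝ} (hab : a < b)
    (h : ∀ x ∈ Ioo a b, |g x| ≤ C) : ∀ x ∈ Icc a b, |g x| ≤ C := by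
  intro x hx
  rw [← closure_Ioo hab.ne] at hx
  exact le_on_closure h hg.abs.continuousOn continuousOn_const hx

/-- If `f` and `f^(n+1)` are bounded by `M` and `M'` on the segment from `x` to `x + 2 a`, then the
Taylor polynomial of `f` at `x` is bounded there by `M + |2 a|^(n+1) / (n+1)! M'`. Markov's
inequality, at the endpoint `x` of the segment, bounds its derivatives, which are those of `f`. -/
theorem abs_iteratedDeriv_mul_pow_le {f : ℝ → ℝ} {n : ℕ}
    (hf : ContDiff ℝ ((n + 1 : ℕ) : WithTop ℕ∞) f) {x a M M' : ℝ} (ha : a ≠ 0)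
    (hM₀ : 0 ≤ M) (hM'₀ : 0 ≤ M')
    (hM : ∀ y ∈ uIcc x (x + 2 * a), |f y| ≤ M)
    (hM' : ∀ y ∈ uIcc x (x + 2 * a), |iteratedDeriv (n + 1) f y| ≤ M') {j : ℕ} (hj : j ≤ n) :
    |a| ^ j * |iteratedDeriv j f x| ≤ (M + |2 * a| ^ (n + 1) / ((n + 1).factorial : ℝ) * M') *
      (Polynomial.derivative^[j] (Polynomial.Chebyshev.T ℝ n)).eval 1 := by
  -- the Taylor polynomial of `f` at `x`, in the coordinate `u` with `y = x + a * (1 - u)`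
  set P : Polynomial ℝ := ∑ k ∈ Finset.range (n + 1),
    Polynomial.C ((k.factorial : ℝ)⁻¹ * (-a) ^ k * iteratedDeriv k f x) *
      (Polynomial.X - Polynomial.C 1) ^ k with hP
  have hdeg : P.degree ≤ n := by
    refine (Polynomial.degree_sum_le _ _).trans (Finset.sup_le fun k hk => ?_)
    rw [← Polynomial.smul_eq_C_mul]
    refine (Polynomial.degree_smul_le _ _).trans ((Polynomial.degree_pow_le _ _).trans ?_)
    rw [Polynomial.degree_X_sub_C, nsmul_eq_mul, mul_one]
    exact_mod_cast Finset.mem_range_succ_iff.mp hk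
  have heval : ∀ u, P.eval u = ∑ k ∈ Finset.range (n + 1),
      (k.factorial : ℝ)⁻¹ * (x + a * (1 - u) - x) ^ k * iteratedDeriv k f x := by
    intro u
    rw [hP, Polynomial.eval_finsetSum]
    refine Finset.sum_congr rfl fun k _ => ?_
    simp only [Polynomial.eval_mul, Polynomial.eval_pow, Polynomial.eval_sub, Polynomial.eval_X,
      Polynomial.eval_C]
    rw [show x + a * (1 - u) - x = -a * (u - 1) by ring, mul_pow]
    ring
  have hmem : ∀ u ∈ Icc (-1 : ℝ) 1, x + a * (1 - u) ∈ uIcc x (x + 2 * a) := by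
    rintro u ⟨hu1, hu2⟩
    rcases le_total 0 a with h | h
    · rw [uIcc_of_le (by linarith)]
      constructor <;> nlinarith
    · rw [uIcc_of_ge (by linarith)]
      constructor <;> nlinarith
  have hbound : ∀ u ∈ Icc (-1 : ℝ) 1,
      |P.eval u| ≤ M + |2 * a| ^ (n + 1) / ((n + 1).factorial : ℝ) * M' := by
    intro u hu
    have hy := hmem u hu
    rcases eq_or_ne u 1 with rfl | hu1
    · have : P.eval 1 = f x := by
        rw [heval, Finset.sum_range_succ']
        simp
      rw [this]
      exact (hM x left_mem_uIcc).trans (le_add_of_nonneg_right (by positivity))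
    · have hne : x ≠ x + a * (1 - u) := by
        have := mul_ne_zero ha (sub_ne_zero.mpr hu1.symm)
        intro h; apply this; linarith
      obtain ⟨ξ, hξ, h⟩ := taylor_lagrange_sum hf hne
      rw [← heval, add_sub_cancel_left] at h
      have hξ' : ξ ∈ uIcc x (x + 2 * a) :=
        uIcc_subset_uIcc_left hy (uIoo_subset_uIcc_self hξ)
      have h2 : P.eval u = f (x + a * (1 - u)) -
          iteratedDeriv (n + 1) f ξ * (a * (1 - u)) ^ (n + 1) / ((n + 1).factorial : ℝ) := by
        linarith
      rw [h2]
      refine (abs_sub _ _).trans (add_le_add (hM _ hy) ?_)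
      rw [abs_div, abs_mul, abs_pow, Nat.abs_cast]
      have h3 : |a * (1 - u)| ≤ |2 * a| := by
        rw [abs_mul, abs_mul, abs_two, mul_comm]
        refine mul_le_mul_of_nonneg_right ?_ (abs_nonneg a)
        rw [abs_le]
        constructor <;> linarith [hu.1, hu.2]
      calc _ ≤ M' * |2 * a| ^ (n + 1) / ((n + 1).factorial : ℝ) := by
            gcongr
            exact hM' ξ hξ'
        _ = _ := by ring
  have hderiv : (Polynomial.derivative^[j] P).eval 1 = (-a) ^ j * iteratedDeriv j f x := by
    rw [hP, Polynomial.iterate_derivative_sum, Polynomial.eval_finsetSum,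
      Finset.sum_eq_single_of_mem j (Finset.mem_range_succ_iff.mpr hj)]
    · rw [Polynomial.iterate_derivative_C_mul, Polynomial.iterate_derivative_X_sub_pow_self]
      simp only [Polynomial.eval_mul, Polynomial.eval_C, Polynomial.eval_natCast]
      field_simp
    · intro k _ hkj
      rw [Polynomial.iterate_derivative_C_mul, Polynomial.iterate_derivative_X_sub_pow]
      rcases lt_or_gt_of_ne hkj with h | h
      · simp [Nat.descFactorial_of_lt h]
      · simp [Nat.sub_ne_zero_of_lt h]
  have := abs_iterate_derivative_eval_one_le (j := j) hdeg (by positivity) hbound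
  rwa [hderiv, abs_mul, abs_pow, abs_neg] at this

theorem abs_iteratedDeriv_le_of_Ioo {lam : ℝ} (hlam : 0 < lam) {f : ℝ → ℝ} {n : ℕ}
    (hf : ContDiff ℝ ((n + 1 : ℕ) : WithTop ℕ∞) f) {M M' : ℝ} (hM₀ : 0 ≤ M) (hM'₀ : 0 ≤ M')
    (hM : ∀ y ∈ Ioo (-lam) lam, |f y| ≤ M)
    (hM' : ∀ y ∈ Ioo (-lam) lam, |iteratedDeriv (n + 1) f y| ≤ M')
    {x : ℝ} (hx : x ∈ Ioo (-lam) lam) {j : ℕ} (hj : j ≤ n) :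
    (lam / 2) ^ j * |iteratedDeriv j f x| ≤
      (M + lam ^ (n + 1) / ((n + 1).factorial : ℝ) * M') *
        (Polynomial.derivative^[j] (Polynomial.Chebyshev.T ℝ n)).eval 1 := by
  have hMc := abs_le_on_Icc_of_Ioo hf.continuous (by linarith) hM
  have hM'c := abs_le_on_Icc_of_Ioo (hf.continuous_iteratedDeriv (n + 1) le_rfl)
    (by linarith) hM'
  -- the half of the interval on the far side of `x` has room for a step of length `lam`
  obtain ⟨a, ha, hsub⟩ : ∃ a, |a| = lam / 2 ∧ uIcc x (x + 2 * a) ⊆ Icc (-lam) lam := by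
    rcases le_total x 0 with h | h
    · refine ⟨lam / 2, abs_of_pos (by linarith), ?_⟩
      exact uIcc_subset_Icc ⟨hx.1.le, hx.2.le⟩ ⟨by linarith [hx.1], by linarith⟩
    · refine ⟨-(lam / 2), by rw [abs_neg, abs_of_pos (by linarith)], ?_⟩
      exact uIcc_subset_Icc ⟨hx.1.le, hx.2.le⟩ ⟨by linarith, by linarith [hx.2]⟩
  have ha0 : a ≠ 0 := by
    rintro rfl
    rw [abs_zero] at ha
    linarith
  have := abs_iteratedDeriv_mul_pow_le hf ha0 hM₀ hM'₀ (fun y hy => hMc y (hsub hy))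
    (fun y hy => hM'c y (hsub hy)) hj
  rwa [abs_mul, abs_two, ha, show 2 * (lam / 2) = lam by ring] at this

theorem iteratedDeriv_eq_zero_of_forall_notMem_Ioo {f : ℝ → ℝ} {k : ℕ}
    (hf : ContDiff ℝ (k : WithTop ℕ∞) f) {a b : ℝ} (h : ∀ x, x ∉ Ioo a b → f x = 0) :
    iteratedDeriv k f a = 0 ∧ iteratedDeriv k f b = 0 := by
  have hc := hf.continuous_iteratedDeriv k le_rfl
  have key : ∀ s : Set ℝ, IsOpen s → (∀ x ∈ s, f x = 0) → ∀ x ∈ closure s,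
      iteratedDeriv k f x = 0 := by
    intro s hs h0 x hx
    refine closure_minimal (t := {x | iteratedDeriv k f x = 0}) (fun y hy => ?_)
      (isClosed_eq hc continuous_const) hx
    have : f =ᶠ[𝓝 y] fun _ => 0 := Filter.eventually_of_mem (hs.mem_nhds hy) h0
    rw [mem_ofPred_eq, this.iteratedDeriv_eq]
    simp
  refine ⟨key (Iio a) isOpen_Iio (fun x hx => h x fun h' => ?_) a ?_,
    key (Ioi b) isOpen_Ioi (fun x hx => h x fun h' => ?_) b ?_⟩
  · exact lt_asymm h'.1 hx
  · simp
  · exact lt_asymm h'.2 hx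
  · simp

theorem iteratedDeriv_iteratedDeriv_add (f : ℝ → ℝ) (i k : ℕ) :
    iteratedDeriv i (iteratedDeriv k f) = iteratedDeriv (i + k) f := by
  simp only [iteratedDeriv_eq_iterate, Function.iterate_add_apply]

/-- Taylor's formula for `f^(k)` at the endpoint of `[-lam, lam]` nearest to `x`, where the
derivatives of `f` up to the order `k + (m + 1)` vanish. -/
theorem abs_iteratedDeriv_le_of_eq_zero {lam : ℝ} {f : ℝ → ℝ} {k m : ℕ}
    (hf : ContDiff ℝ ((k + (m + 1) : ℕ) : WithTop ℕ∞) f)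
    (h0 : ∀ x, x ∉ Ioo (-lam) lam → f x = 0) {W : ℝ}
    (hW : ∀ x, |iteratedDeriv (k + (m + 1)) f x| ≤ W) {x : ℝ} (hx : x ∈ Ioo (-lam) lam) :
    |iteratedDeriv k f x| ≤ lam ^ (m + 1) / ((m + 1).factorial : ℝ) * W := by
  obtain ⟨c, hc, hne, hcx⟩ : ∃ c, (c = -lam ∨ c = lam) ∧ c ≠ x ∧ |x - c| ≤ lam := by
    rcases le_total x 0 with h | h
    · exact ⟨-lam, Or.inl rfl, hx.1.ne, by rw [abs_le]; constructor <;> linarith [hx.1]⟩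
    · exact ⟨lam, Or.inr rfl, hx.2.ne', by rw [abs_le]; constructor <;> linarith [hx.2]⟩
  have hg : ContDiff ℝ ((m + 1 : ℕ) : WithTop ℕ∞) (iteratedDeriv k f) := by
    rw [iteratedDeriv_eq_iterate]
    exact ContDiff.iterate_deriv' (m + 1) k (by rw [add_comm] at hf; exact_mod_cast hf)
  obtain ⟨ξ, -, h⟩ := taylor_lagrange_sum hg hne
  rw [Finset.sum_eq_zero, sub_zero, iteratedDeriv_iteratedDeriv_add, add_comm (m + 1) k] at h
  · rw [h, abs_div, abs_mul, abs_pow, Nat.abs_cast]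
    have := hW ξ
    have hW0 := (abs_nonneg _).trans this
    calc _ ≤ W * lam ^ (m + 1) / ((m + 1).factorial : ℝ) := by gcongr
      _ = _ := by ring
  · intro i hi
    have hi := Finset.mem_range.mp hi
    have := iteratedDeriv_eq_zero_of_forall_notMem_Ioo (k := i + k)
      (hf.of_le (by exact_mod_cast (by omega : i + k ≤ k + (m + 1)))) h0
    rw [iteratedDeriv_iteratedDeriv_add]
    rcases hc with rfl | rfl
    · rw [this.1, mul_zero]
    · rw [this.2, mul_zero]

/-! ### The Leibniz formula -/

/-- The bound for `(w ψ)^(s+1)` on `(-π, π)`. -/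
theorem abs_iteratedDeriv_mul_le {s : ℕ} (hs : 1 ≤ s) {ψ w : ℝ → ℝ}
    (hψ : ContDiff ℝ ((s + 1 : ℕ) : WithTop ℕ∞) ψ) (hw : ContDiff ℝ ((s + 1 : ℕ) : WithTop ℕ∞) w)
    {M M' W : ℝ} (hM₀ : 0 ≤ M) (hM'₀ : 0 ≤ M')
    (hM : ∀ x ∈ Ioo (-Real.pi) Real.pi, |ψ x| ≤ M)
    (hM' : ∀ x ∈ Ioo (-Real.pi) Real.pi, |iteratedDeriv (s + 1) ψ x| ≤ M')
    (hw1 : ∀ x ∈ Ioo (-Real.pi) Real.pi, |w x| ≤ 1)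
    (hw0 : ∀ x, x ∉ Ioo (-Real.pi) Real.pi → w x = 0)
    (hW : ∀ x, |iteratedDeriv (s + 1) w x| ≤ W) {x : ℝ} (hx : x ∈ Ioo (-Real.pi) Real.pi) :
    |iteratedDeriv (s + 1) (w * ψ) x| ≤
      M' + M * W + constC s M M' * constC s 1 W / (2 * Real.pi) ^ (s + 1) * constK s := by
  have hπ := Real.pi_pos
  have hW₀ : 0 ≤ W := (abs_nonneg _).trans (hW x)
  have hC₀ : 0 ≤ constC s M M' := by unfold constC; positivity
  set T : ℕ → ℝ := fun j => (Polynomial.derivative^[j] (Polynomial.Chebyshev.T ℝ s)).eval 1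
  have hT₀ : ∀ j, 0 ≤ T j := iterate_derivative_T_eval_one_nonneg s
  have hterm : ∀ j ∈ Finset.Icc 1 s, |((s + 1).choose j : ℝ) * iteratedDeriv j ψ x *
      iteratedDeriv (s + 1 - j) w x| ≤
      constC s M M' * W * (((s + 1).choose j : ℝ) * (2 ^ j / (j.factorial : ℝ)) * T j) := by
    intro j hj
    obtain ⟨hj1, hj2⟩ := Finset.mem_Icc.mp hj
    have h1 : |iteratedDeriv j ψ x| ≤ (2 / Real.pi) ^ j * (constC s M M' * T j) := by
      have h := abs_iteratedDeriv_le_of_Ioo hπ hψ hM₀ hM'₀ hM hM' hx hj2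
      have hC : M + Real.pi ^ (s + 1) / ((s + 1).factorial : ℝ) * M' ≤ constC s M M' := by
        unfold constC
        gcongr
        linarith
      have h' := h.trans (mul_le_mul_of_nonneg_right hC (hT₀ j))
      calc |iteratedDeriv j ψ x|
          = (2 / Real.pi) ^ j * ((Real.pi / 2) ^ j * |iteratedDeriv j ψ x|) := by
            rw [← mul_assoc, ← mul_pow, show 2 / Real.pi * (Real.pi / 2) = 1 by field_simp,
              one_pow, one_mul]
        _ ≤ _ := by gcongr
    have h2 : |iteratedDeriv (s + 1 - j) w x| ≤ Real.pi ^ j / (j.factorial : ℝ) * W := by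
      obtain ⟨m, rfl⟩ : ∃ m, j = m + 1 := ⟨j - 1, by omega⟩
      have e : s + 1 - (m + 1) + (m + 1) = s + 1 := by omega
      exact abs_iteratedDeriv_le_of_eq_zero (k := s + 1 - (m + 1)) (m := m)
        (by rw [e]; exact hw) hw0 (by rw [e]; exact hW) hx
    rw [abs_mul, abs_mul, Nat.abs_cast]
    calc _ ≤ ((s + 1).choose j : ℝ) * ((2 / Real.pi) ^ j * (constC s M M' * T j)) *
          (Real.pi ^ j / (j.factorial : ℝ) * W) := by
          have := hT₀ j
          gcongr
      _ = _ := by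
        rw [div_pow]
        field_simp
  have hsplit : Finset.range (s + 1 + 1) = insert 0 (insert (s + 1) (Finset.Icc 1 s)) := by
    ext j; simp only [Finset.mem_range, Finset.mem_insert, Finset.mem_Icc]; omega
  rw [mul_comm w ψ, iteratedDeriv_mul hψ.contDiffAt hw.contDiffAt, hsplit,
    Finset.sum_insert (by simp), Finset.sum_insert (by simp)]
  simp only [Nat.choose_zero_right, Nat.choose_self, Nat.cast_one, one_mul, Nat.sub_self,
    Nat.sub_zero, iteratedDeriv_zero]
  have hfirst : |ψ x * iteratedDeriv (s + 1) w x| ≤ M * W := by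
    rw [abs_mul]
    exact mul_le_mul (hM x hx) (hW x) (abs_nonneg _) hM₀
  have hlast : |iteratedDeriv (s + 1) ψ x * w x| ≤ M' := by
    rw [abs_mul]
    exact (mul_le_mul (hM' x hx) (hw1 x hx) (abs_nonneg _) hM'₀).trans_eq (mul_one _)
  have hmid : |∑ j ∈ Finset.Icc 1 s, ((s + 1).choose j : ℝ) * iteratedDeriv j ψ x *
      iteratedDeriv (s + 1 - j) w x| ≤
      constC s M M' * constC s 1 W / (2 * Real.pi) ^ (s + 1) * constK s := by
    have hK₀ : 0 ≤ constK s := by unfold constK; positivity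
    calc _ ≤ ∑ j ∈ Finset.Icc 1 s, constC s M M' * W *
          (((s + 1).choose j : ℝ) * (2 ^ j / (j.factorial : ℝ)) * T j) :=
          (Finset.abs_sum_le_sum_abs _ _).trans (Finset.sum_le_sum hterm)
      _ ≤ constC s M M' * W * (constK s / ((s + 1).factorial : ℝ)) := by
          rw [← Finset.mul_sum]
          exact mul_le_mul_of_nonneg_left (sum_choose_mul_iterate_derivative_T_le hs)
            (by positivity)
      _ = constC s M M' * ((2 * Real.pi) ^ (s + 1) / ((s + 1).factorial : ℝ) * W) /
            (2 * Real.pi) ^ (s + 1) * constK s := by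
          field_simp
      _ ≤ _ := by
          gcongr
          unfold constC
          linarith
  refine (abs_add_le _ _).trans ?_
  have := abs_add_le (iteratedDeriv (s + 1) ψ x * w x)
    (∑ j ∈ Finset.Icc 1 s, ((s + 1).choose j : ℝ) * iteratedDeriv j ψ x *
      iteratedDeriv (s + 1 - j) w x)
  linarith

/-! ### The periodization -/

theorem periodization_eq_comp_toIocMod {lam : ℝ} (hlam : 0 < lam) {f : ℝ → ℝ} (hf : Continuous f)
    (h1 : f (-lam) = 0) (h2 : f lam = 0) (x : ℝ) :
    periodization lam hlam f x = f (toIocMod (mul_pos two_pos hlam) (-lam) x) := by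
  unfold periodization
  split_ifs with h
  · rfl
  · have hle := toIocMod_le_right (mul_pos two_pos hlam) (-lam) x
    have : toIocMod (mul_pos two_pos hlam) (-lam) x = lam := by linarith
    rw [this, hf.continuousWithinAt.rightLim_eq, hf.continuousWithinAt.leftLim_eq, h1, h2]
    norm_num

/-- Around the seam `lam`, the periodization of a function vanishing outside `(-lam, lam)` is a sum
of two translates of that function. -/
theorem periodization_eq_add {lam : ℝ} (hlam : 0 < lam) {f : ℝ → ℝ} (hf : Continuous f)
    (h0 : ∀ x, x ∉ Ioo (-lam) lam → f x = 0) {x : ℝ} (hx : x ∈ Ioc (-lam) (3 * lam)) :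
    periodization lam hlam f x = f x + f (x - 2 * lam) := by
  rw [periodization_eq_comp_toIocMod hlam hf (h0 _ (by simp)) (h0 _ (by simp))]
  have hp := mul_pos two_pos hlam
  rcases le_or_gt x lam with h | h
  · rw [(toIocMod_eq_self hp).mpr ⟨hx.1, by linarith⟩, h0 (x - 2 * lam), add_zero]
    intro h'
    linarith [h'.1]
  · rw [← toIocMod_sub hp, (toIocMod_eq_self hp).mpr ⟨by linarith, by linarith [hx.2]⟩,
      h0 x, zero_add]
    intro h'
    linarith [h'.2]

theorem contDiff_periodization {lam : ℝ} (hlam : 0 < lam) {f : ℝ → ℝ} {n : WithTop ℕ∞}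
    (hf : ContDiff ℝ n f) (h0 : ∀ x, x ∉ Ioo (-lam) lam → f x = 0) :
    ContDiff ℝ n (periodization lam hlam f) := by
  have hp := mul_pos two_pos hlam
  have hbase : ∀ y ∈ Ioo (-lam) (3 * lam), ContDiffAt ℝ n (periodization lam hlam f) y := by
    intro y hy
    have hg : ContDiff ℝ n fun x => f x + f (x - 2 * lam) :=
      hf.add (hf.comp (contDiff_id.sub contDiff_const))
    refine hg.contDiffAt.congr_of_eventuallyEq ?_
    filter_upwards [isOpen_Ioo.mem_nhds hy] with x hx
    exact periodization_eq_add hlam hf.continuous h0 ⟨hx.1, hx.2.le⟩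
  refine contDiff_iff_contDiffAt.mpr fun x => ?_
  -- translate by the multiple of the period that moves `x` into the fundamental domain
  set c := toIocDiv hp (-lam) x • (2 * lam) with hc
  have hmod : x - c = toIocMod hp (-lam) x := self_sub_toIocDiv_zsmul hp (-lam) x
  have hmem := toIocMod_mem_Ioc hp (-lam) x
  rw [← hmod] at hmem
  have hper : periodization lam hlam f = periodization lam hlam f ∘ fun y => y - c := by
    funext y
    simp only [Function.comp_apply, periodization, hc, toIocMod_sub_zsmul]
  rw [hper]
  exact (hbase (x - c) ⟨hmem.1, by linarith [hmem.2]⟩).comp x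
    (contDiff_id.sub contDiff_const).contDiffAt

theorem periodization_eqOn_Ioo {lam : ℝ} (hlam : 0 < lam) (f : ℝ → ℝ) :
    EqOn (periodization lam hlam f) f (Ioo (-lam) lam) := by
  intro x hx
  have : toIocMod (mul_pos two_pos hlam) (-lam) x = x :=
    (toIocMod_eq_self _).mpr ⟨hx.1, by linarith [hx.2]⟩
  simp only [periodization, this, if_pos hx.2]

/-! ### The best Lipschitz constant -/

/-- The best Lipschitz constant exists because the set of admissible constants is closed. -/
theorem exists_isLipschitzConst_le {f : ℝ → ℝ} {S : Set ℝ} {K : ℝ} (hK : 0 ≤ K)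
    (h : ∀ x ∈ S, ∀ y ∈ S, |f x - f y| ≤ K * |x - y|) :
    ∃ L, IsLipschitzConst f S L ∧ L ≤ K := by
  set A := {K : ℝ | 0 ≤ K ∧ ∀ x ∈ S, ∀ y ∈ S, |f x - f y| ≤ K * |x - y|}
  have hbdd : BddBelow A := ⟨0, fun K hK => hK.1⟩
  have hmem : K ∈ A := ⟨hK, h⟩
  have hclosed : IsClosed A := by
    have : A = Ici 0 ∩ ⋂ x ∈ S, ⋂ y ∈ S, {K : ℝ | |f x - f y| ≤ K * |x - y|} := by
      ext K
      simp [A]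
    rw [this]
    exact isClosed_Ici.inter (isClosed_biInter fun x _ => isClosed_biInter fun y _ =>
      isClosed_le continuous_const (continuous_id.mul continuous_const))
  exact ⟨sInf A, ⟨hclosed.csInf_mem ⟨K, hmem⟩ hbdd, fun _ h => csInf_le hbdd h⟩,
    csInf_le hbdd hmem⟩

end WindowedFourier

theorem mainTheorem2 (s : ℕ) (hs : 1 ≤ s) (ρ : ℝ) (hρ₀ : 0 ≤ ρ) (hρ : ρ < Real.pi)
    (ψ w : ℝ → ℝ) (hψ : ContDiff ℝ ((s + 1 : ℕ) : WithTop ℕ∞) ψ)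
    (hw : WindowedFourier.IsBump (s + 1) ρ Real.pi w)
    (M M' : ℝ) (hM₀ : 0 ≤ M) (hM'₀ : 0 ≤ M')
    (hM : ∀ x ∈ Set.Ioo (-Real.pi) Real.pi, |ψ x| ≤ M)
    (hM' : ∀ x ∈ Set.Ioo (-Real.pi) Real.pi, |iteratedDeriv (s + 1) ψ x| ≤ M') :
    ContDiff ℝ ((s + 1 : ℕ) : WithTop ℕ∞)
        (WindowedFourier.windowedPeriodization Real.pi 0 w ψ) ∧
      BddAbove (Set.range fun x => |iteratedDeriv (s + 1) w x|) ∧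
      ∃ L : ℝ,
        WindowedFourier.IsLipschitzConst
          (iteratedDeriv s (WindowedFourier.windowedPeriodization Real.pi 0 w ψ))
          (Set.Icc (-Real.pi) Real.pi) L ∧
        L ≤ M' + M * WindowedFourier.supNorm (iteratedDeriv (s + 1) w) +
          WindowedFourier.constC s M M' *
            WindowedFourier.constC s 1 (WindowedFourier.supNorm (iteratedDeriv (s + 1) w)) /
            (2 * Real.pi) ^ (s + 1) * WindowedFourier.constK s := by
  have hwC : ContDiff ℝ ((s + 1 : ℕ) : WithTop ℕ∞) w := hw.contDiff
  have hF : WindowedFourier.windowedPeriodization Real.pi 0 w ψ =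
      WindowedFourier.periodization Real.pi Real.pi_pos (w * ψ) := by
    unfold WindowedFourier.windowedPeriodization
    congr 1
    funext x
    simp [WindowedFourier.scaling, WindowedFourier.translation, Real.pi_ne_zero]
  have hzero : ∀ x, x ∉ Ioo (-Real.pi) Real.pi → (w * ψ) x = 0 := fun x hx => by
    rw [Pi.mul_apply, hw.eq_zero x hx, zero_mul]
  have hFC : ContDiff ℝ ((s + 1 : ℕ) : WithTop ℕ∞)
      (WindowedFourier.windowedPeriodization Real.pi 0 w ψ) := by
    rw [hF]
    exact WindowedFourier.contDiff_periodization Real.pi_pos (hwC.mul hψ) hzero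
  have hbdd : BddAbove (Set.range fun x => |iteratedDeriv (s + 1) w x|) := by
    obtain ⟨C, hC⟩ := (hwC.continuous_iteratedFDeriv le_rfl).bounded_above_of_compact_support
      (hw.hasCompactSupport.iteratedFDeriv (𝕜 := ℝ) (s + 1))
    refine ⟨C, ?_⟩
    rintro _ ⟨x, rfl⟩
    simpa only [norm_iteratedFDeriv_eq_norm_iteratedDeriv, Real.norm_eq_abs] using hC x
  refine ⟨hFC, hbdd, ?_⟩
  set W := WindowedFourier.supNorm (iteratedDeriv (s + 1) w)
  have hW : ∀ x, |iteratedDeriv (s + 1) w x| ≤ W := le_ciSup hbdd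
  set F := WindowedFourier.windowedPeriodization Real.pi 0 w ψ
  set B := M' + M * W + WindowedFourier.constC s M M' * WindowedFourier.constC s 1 W /
    (2 * Real.pi) ^ (s + 1) * WindowedFourier.constK s
  have hder : ∀ x ∈ Icc (-Real.pi) Real.pi, |iteratedDeriv (s + 1) F x| ≤ B := by
    refine WindowedFourier.abs_le_on_Icc_of_Ioo (hFC.continuous_iteratedDeriv (s + 1) le_rfl)
      (by linarith [Real.pi_pos]) fun x hx => ?_
    have : F =ᶠ[𝓝 x] w * ψ := by
      rw [hF]
      exact (WindowedFourier.periodization_eqOn_Ioo Real.pi_pos (w * ψ)).eventuallyEq_of_mem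
        (isOpen_Ioo.mem_nhds hx)
    rw [this.iteratedDeriv_eq]
    refine WindowedFourier.abs_iteratedDeriv_mul_le hs hψ hwC hM₀ hM'₀ hM hM' (fun y hy => ?_)
      hw.eq_zero hW hx
    have := hw.mem_Icc y hy
    exact abs_le.mpr ⟨by linarith, this.2⟩
  refine WindowedFourier.exists_isLipschitzConst_le
    ((abs_nonneg _).trans (hder 0 ⟨by linarith [Real.pi_pos], Real.pi_pos.le⟩))
    fun x hx y hy => ?_
  have hd : Differentiable ℝ (iteratedDeriv s F) :=
    hFC.differentiable_iteratedDeriv s (by exact_mod_cast Nat.lt_succ_self s)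
  exact (convex_Icc (-Real.pi) Real.pi).norm_image_sub_le_of_norm_deriv_le
    (fun z _ => hd z) (fun z hz => by rw [← iteratedDeriv_succ]; exact hder z hz) hy hx
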